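/- For a size vector $a\in[0,1]^n$ let $P(a)=\{x\in[0,1]^n : \sum_i a_ix_i\le 1\}$ be the fractional knapsack polytope and let $P_I(a)$ be the convex hull of $P(a)\cap\{0,1\}^n$. A contention resolution scheme (CRS) for $P(a)$ is a randomized procedure that, for every $x\in P(a)$ and every $R\subseteq\mathrm{supp}(x)$, returns a random point $y_x^R\in P_I(a)$ with $\mathrm{supp}(y_x^R)\subseteq R$. It is monotone if $\mathbb{E}[(y_x^A)_i]\ge\mathbb{E}[(y_x^B)_i]$ for all $x\in P(a)$ and $i\in A\subseteq B\subseteq\mathrm{supp}(x)$. It is $c$-balanced if for all $x\in P(a)$ and all $i\in\mathrm{supp}(x)$ we have $\mathbb{E}[(y_x^R)_i]\ge c\,x_i$ (equivalently $\mathbb{E}[(y_x^R)_i\mid i\in R]\ge c$), where $R$ is a random set containing each item $j$ independently with probability $x_j$. A size vector is of class $1$ if $a_i\in(\frac12,1]$ for all $i$. Consider the following procedure with input $x$ and $R\subseteq\mathrm{supp}(x)$. Sample each item $i\in R$ independently with probability $\frac{1-e^{-x_i}}{x_i}$; for each sampled item $i$ let $q_i$ be an independent realization of a $\mathrm{Pois}(x_i)$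 random variable conditioned on being at least $1$; put $q_i=0$ for all other items; return $y_x^R$ with $(y_x^R)_i=q_i/\sum_j q_j$ (and $y_x^R=0$ if no item was sampled). Then: 1. For every $n$ and every class-$1$ size vector $a\in(\frac12,1]^n$, this procedure is a monotone $\frac{1-e^{-2}}{2}$-balanced CRS for $P(a)$. 2. $\mathbb{E}\left[\frac{1}{1+\mathrm{Pois}(2)}\right]=\frac{1-e^{-2}}{2}$. 3. The balancedness is optimal: if $c\in\mathbb{R}$ is such that for every $n$ and every class-$1$ size vector $a\in(\frac12,1]^n$ there is a (not necessarily monotone) $c$-balanced CRS for $P(a)$, then $c\le\frac{1-e^{-2}}{2}$. -/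

import Mathlib

open MeasureTheory ProbabilityTheory

noncomputable section

namespace Knapsack

/-- The fractional knapsack polytope `P(a)` (with capacity normalized to `1`). -/
def fracPolytope {n : ℕ} (a : Fin n → ℝ) : Set (Fin n → ℝ) :=
  {x | (∀ i, 0 ≤ x i ∧ x i ≤ 1) ∧ ∑ i, a i * x i ≤ 1}

/-- The integer hull `P_I(a)`: the convex hull of the `0/1`-points of `P(a)`. -/
def intPolytope {n : ℕ} (a : Fin n → ℝ) : Set (Fin n → ℝ) :=
  convexHull ℝ {z | z ∈ fracPolytope a ∧ ∀ i, z i = 0 ∨ z i = 1}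

/-- Every item is a class-`k` item: its size lies in `(1/(k+1), 1/k]`. -/
def IsClass {n : ℕ} (k : ℕ) (a : Fin n → ℝ) : Prop :=
  ∀ i, a i ∈ Set.Ioc (1 / ((k : ℝ) + 1)) (1 / (k : ℝ))

/-- A randomized procedure: to a point `x` and a set `R` of items it assigns the law of
its random output vector `y_x^R`. -/
abbrev Scheme (n : ℕ) : Type :=
  (Fin n → ℝ) → Finset (Fin n) → Measure (Fin n → ℝ)

/-- `π` is a contention resolution scheme for `P(a)`: for every `x ∈ P(a)` and every
`R ⊆ supp(x)` it outputs a random point of `P_I(a)` whose support is contained in `R`. -/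
def IsCRS {n : ℕ} (a : Fin n → ℝ) (π : Scheme n) : Prop :=
  ∀ x ∈ fracPolytope a, ∀ R : Finset (Fin n), (∀ i ∈ R, x i ≠ 0) →
    IsProbabilityMeasure (π x R) ∧
      ∀ᵐ y ∂(π x R), y ∈ intPolytope a ∧ ∀ i, y i ≠ 0 → i ∈ R

/-- Monotonicity: `E[(y_x^A)_i] ≥ E[(y_x^B)_i]` whenever `x ∈ P(a)` and
`i ∈ A ⊆ B ⊆ supp(x)`. -/
def IsMonotone {n : ℕ} (a : Fin n → ℝ) (π : Scheme n) : Prop :=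
  ∀ x ∈ fracPolytope a, ∀ A B : Finset (Fin n), A ⊆ B → (∀ i ∈ B, x i ≠ 0) →
    ∀ i ∈ A, ∫ y, y i ∂(π x B) ≤ ∫ y, y i ∂(π x A)

/-- The probability that the random set containing each item `i` independently with
probability `x i` equals `R`. -/
def inclusionProb {n : ℕ} (x : Fin n → ℝ) (R : Finset (Fin n)) : ℝ :=
  (∏ i ∈ R, x i) * ∏ i ∈ Rᶜ, (1 - x i)

/-- `c`-balancedness: if `R` contains each item `i` independently with probability `x i`,
then `E[(y_x^R)_i] ≥ c * x i` for all `i ∈ supp(x)`; as `(y_x^R)_i = 0` for `i ∉ R`, this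
says `E[(y_x^R)_i | i ∈ R] ≥ c`. Sets `R` not contained in `supp(x)` have weight zero. -/
def IsBalanced {n : ℕ} (c : ℝ) (a : Fin n → ℝ) (π : Scheme n) : Prop :=
  ∀ x ∈ fracPolytope a, ∀ i, x i ≠ 0 →
    c * x i ≤ ∑ R : Finset (Fin n), inclusionProb x R * ∫ y, y i ∂(π x R)

/-- The law of the weight `q_i` of an item `i ∈ R` with `x i = t > 0`: with probability
`(1 - e^{-t}) / t` the item is sampled, and then `q_i` is a `Pois(t)` variable conditioned
on being at least `1`; otherwise the item is not sampled and `q_i = 0`. -/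
def weightLaw (t : ℝ) : Measure ℕ :=
  ENNReal.ofReal ((1 - Real.exp (-t)) / t) •
      ProbabilityTheory.cond (poissonMeasure t.toNNReal) {q : ℕ | 1 ≤ q} +
    ENNReal.ofReal (1 - (1 - Real.exp (-t)) / t) • Measure.dirac 0

/-- The normalized vector `q_i / ∑ j, q_j`; it is `0` if all weights vanish. -/
def normalizeWeights {n : ℕ} (q : Fin n → ℕ) : Fin n → ℝ :=
  fun i => (q i : ℝ) / ∑ j, (q j : ℝ)

/-- The Poisson-weighted scheme for class-`1` instances: the weights `q_i` are independent,
distributed as `weightLaw (x i)` for `i ∈ R` and equal to `0` for `i ∉ R`; the output is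
the vector of normalized weights. -/
def poissonScheme (n : ℕ) : Scheme n := fun x R =>
  (Measure.pi fun i => if i ∈ R then weightLaw (x i) else Measure.dirac 0).map
    normalizeWeights

end Knapsack

end

namespace Knapsack

open scoped Nat NNReal

/-! Averaged over the random set `R`, item `i` is sampled with probability `1 - e^{-x_i}`, so its
weight is exactly `Pois(x_i)` and the weights are independent
(`sum_inclusionProb_smul_weightVectorLaw`). Size-biasing in coordinate `i` then gives `E[q_i / ∑
q_j] = x_i E[1 / (1 + Pois(s))] = x_i (1 - e^{-s}) / s` with `s = ∑ x_j`. This factor decreases in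
`s`, and `s ≤ 2` because all sizes exceed `1/2`.

Monotonicity is a coupling: discarding items only removes terms from the denominator.

For optimality, at most one item fits and none is available when `R = ∅`, so `c * s ≤ 1 - ∏ (1 -
x_i)` (`IsBalanced.mul_sum_le`). Many identical items of size just above `1/2` give `s → 2` and
right-hand side `→ 1 - e^{-2}`. -/

/-! ### One-dimensional Poisson computations. -/

lemma integral_one_div_one_add_poissonMeasure {r : ℝ≥0} (hr : 0 < r) :
    ∫ k : ℕ, 1 / (1 + (k : ℝ)) ∂(poissonMeasure r) = (1 - Real.exp (-r)) / r := by
  rw [integral_poissonMeasure]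
  have h := ((hasSum_nat_add_iff' 1).2 (hasSum_one_poissonMeasure r)).div_const (r : ℝ)
  simp only [Finset.range_one, Finset.sum_singleton, pow_zero, Nat.factorial_zero, Nat.cast_one,
    mul_one, div_one] at h
  rw [← h.tsum_eq]
  have hr' : (r : ℝ) ≠ 0 := by exact_mod_cast hr.ne'
  congr with k
  have hk : (k ! : ℝ) ≠ 0 := by positivity
  have hk' : (1 + k : ℝ) ≠ 0 := by positivity
  rw [Nat.factorial_succ, smul_eq_mul]
  push_cast
  field_simp
  ring

/-- Convexity of `exp`, since `-r` is the convex combination of `-s` and `0` with weight `r / s` on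
`-s`. -/
lemma one_sub_exp_neg_div_antitone {r s : ℝ} (hr : 0 < r) (hrs : r ≤ s) :
    (1 - Real.exp (-s)) / s ≤ (1 - Real.exp (-r)) / r := by
  have hs : 0 < s := hr.trans_le hrs
  have h := convexOn_exp.2 (Set.mem_univ (-s)) (Set.mem_univ (0 : ℝ))
    (show 0 ≤ r / s by positivity) (sub_nonneg.2 ((div_le_one hs).2 hrs)) (add_sub_cancel _ _)
  have e : (r / s) • (-s) + (1 - r / s) • (0 : ℝ) = -r := by
    simp only [smul_eq_mul]; field_simp; ring
  rw [e, Real.exp_zero, smul_eq_mul, smul_eq_mul] at h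
  rw [le_div_iff₀ hr]
  calc (1 - Real.exp (-s)) / s * r = 1 - (r / s * Real.exp (-s) + (1 - r / s) * 1) := by ring
    _ ≤ 1 - Real.exp (-r) := by linarith

lemma one_sub_exp_neg_div_mem_Icc {t : ℝ} (ht : 0 ≤ t) :
    (1 - Real.exp (-t)) / t ∈ Set.Icc 0 1 := by
  have h1 : Real.exp (-t) ≤ 1 := Real.exp_le_one_iff.2 (by linarith)
  have h2 := Real.add_one_le_exp (-t)
  exact ⟨div_nonneg (by linarith) ht, div_le_one_of_le₀ (by linarith) ht⟩

lemma poissonMeasure_one_le (r : ℝ≥0) :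
    poissonMeasure r {q : ℕ | 1 ≤ q} = ENNReal.ofReal (1 - Real.exp (-r)) := by
  have e : {q : ℕ | 1 ≤ q} = {0}ᶜ := by ext q; simp [Nat.one_le_iff_ne_zero]
  rw [e, prob_compl_eq_one_sub (measurableSet_singleton 0), poissonMeasure_singleton,
    ENNReal.ofReal_sub _ (Real.exp_pos _).le]
  simp

lemma isProbabilityMeasure_weightLaw {t : ℝ} (ht : 0 ≤ t) :
    IsProbabilityMeasure (weightLaw t) := by
  obtain ⟨h0, h1⟩ := one_sub_exp_neg_div_mem_Icc ht
  -- At `t = 0` the quotient is `0 / 0 = 0`, so `weightLaw 0` is the Dirac mass at `0`.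
  rcases ht.eq_or_lt with rfl | ht
  · constructor; simp [weightLaw]
  · have : IsProbabilityMeasure (cond (poissonMeasure t.toNNReal) {q : ℕ | 1 ≤ q}) := by
      apply cond_isProbabilityMeasure
      rw [poissonMeasure_one_le, Real.coe_toNNReal _ ht.le]
      simpa using ht
    constructor
    simp only [weightLaw, Measure.add_apply, Measure.smul_apply, measure_univ, smul_eq_mul, mul_one]
    rw [← ENNReal.ofReal_add h0 (by linarith)]
    simp

/-- Including an item with probability `t` and then drawing its weight from `weightLaw t`
produces a Poisson weight. -/
lemma ofReal_smul_weightLaw_add {t : ℝ} (ht : 0 ≤ t) (ht1 : t ≤ 1) :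
    ENNReal.ofReal t • weightLaw t + ENNReal.ofReal (1 - t) • Measure.dirac 0 =
      poissonMeasure t.toNNReal := by
  obtain ⟨h0, h1⟩ := one_sub_exp_neg_div_mem_Icc ht
  have he : 0 ≤ 1 - Real.exp (-t) := sub_nonneg.2 (Real.exp_le_one_iff.2 (by linarith))
  refine Measure.ext_of_singleton fun k => ?_
  simp only [weightLaw, Measure.add_apply, Measure.smul_apply, smul_eq_mul]
  rw [cond_apply .of_discrete, poissonMeasure_one_le, Real.coe_toNNReal _ ht]
  rcases ht.eq_or_lt with rfl | ht
  · rcases k with _ | k <;> simp [poissonMeasure_singleton]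
  rcases k with _ | k
  · have : {q : ℕ | 1 ≤ q} ∩ {0} = ∅ := by ext; simp
    simp only [this, measure_empty, mul_zero, zero_add, Measure.dirac_apply,
      Set.mem_singleton_iff, Set.indicator_of_mem, Pi.one_apply, mul_one]
    rw [← ENNReal.ofReal_mul ht.le, ← ENNReal.ofReal_add (mul_nonneg ht.le (by linarith))
      (by linarith), poissonMeasure_singleton, Real.coe_toNNReal _ ht.le]
    congr 1
    simp
    field_simp
    ring
  · have : {q : ℕ | 1 ≤ q} ∩ {k + 1} = {k + 1} := by ext; simp
    have he' : 0 < 1 - Real.exp (-t) := by simpa using ht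
    have hd : (Measure.dirac 0 : Measure ℕ) {k + 1} = 0 := by simp
    rw [this, hd, mul_zero, mul_zero, add_zero, add_zero, ← mul_assoc, ← mul_assoc,
      ← ENNReal.ofReal_mul ht.le, mul_div_cancel₀ _ ht.ne',
      ENNReal.mul_inv_cancel (by simpa using ht) ENNReal.ofReal_ne_top, one_mul]

/-! ### Vectors of independent Poisson variables. -/

variable {n : ℕ}

/-- Size-biasing of one coordinate of a vector of independent Poisson variables. -/
lemma withDensity_pi_poissonMeasure (r : Fin n → ℝ≥0) (i : Fin n) :
    (Measure.pi fun j => poissonMeasure (r j)).withDensity (fun q => ((q i : ℝ≥0) : ENNReal)) =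
      (r i : ENNReal) • (Measure.pi fun j => poissonMeasure (r j)).map (· + Pi.single i 1) := by
  refine Measure.ext_of_singleton fun q => ?_
  rw [withDensity_apply _ .of_discrete, lintegral_singleton, Measure.smul_apply,
    Measure.map_apply .of_discrete .of_discrete, smul_eq_mul]
  -- Points with `q i = 0` have density zero and are missed by the shift. Elsewhere the identity is
  -- `(k + 1) r^(k+1) / (k+1)! = r * r^k / k!`.
  rcases Nat.eq_zero_or_pos (q i) with h | h
  · have : (· + Pi.single i 1) ⁻¹' {q} = (∅ : Set (Fin n → ℕ)) := by
      ext p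
      simp only [Set.mem_preimage, Set.mem_singleton_iff, Set.mem_empty_iff_false, iff_false]
      rintro rfl
      simp at h
    simp [this, h]
  · obtain ⟨p, rfl⟩ : ∃ p : Fin n → ℕ, p + Pi.single i 1 = q := by
      refine ⟨q - Pi.single i 1, funext fun j => ?_⟩
      rcases eq_or_ne j i with rfl | hj
      · simp; omega
      · simp [hj]
    have : (· + Pi.single i 1) ⁻¹' {p + Pi.single i 1} = ({p} : Set (Fin n → ℕ)) := by
      ext; simp
    rw [this, Measure.pi_singleton, Measure.pi_singleton, ← Finset.mul_prod_erase _ _ (Finset.mem_univ i),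
      ← Finset.mul_prod_erase _ (fun j => poissonMeasure (r j) {p j}) (Finset.mem_univ i),
      ← mul_assoc, ← mul_assoc]
    congr 1
    · rw [poissonMeasure_singleton, poissonMeasure_singleton, ENNReal.coe_nnreal_eq,
        ENNReal.coe_nnreal_eq, ← ENNReal.ofReal_mul (by positivity),
        ← ENNReal.ofReal_mul (by positivity)]
      congr 1
      have hk : ((p i) ! : ℝ) ≠ 0 := by positivity
      have hk' : (p i + 1 : ℝ) ≠ 0 := by positivity
      simp only [Pi.add_apply, Pi.single_eq_same, Nat.factorial_succ, pow_succ]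
      push_cast
      field_simp
    · refine Finset.prod_congr rfl fun j hj => ?_
      simp [Finset.ne_of_mem_erase hj]

lemma hasLaw_sum_pi_poissonMeasure (r : Fin n → ℝ≥0) (s : Finset (Fin n)) :
    HasLaw (∑ j ∈ s, fun q : Fin n → ℕ => q j) (poissonMeasure (∑ j ∈ s, r j))
      (Measure.pi fun j => poissonMeasure (r j)) := by
  induction s using Finset.induction_on with
  | empty =>
    refine ⟨.of_discrete, ?_⟩
    have h0 : poissonMeasure 0 = Measure.dirac 0 :=
      Measure.ext_of_singleton fun k => by
        rcases k with _ | k <;> simp [poissonMeasure_singleton]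
    simp only [Finset.sum_empty, h0]
    change Measure.map (fun _ => 0) _ = _
    simp
  | insert i s hi ih =>
    rw [Finset.sum_insert hi, Finset.sum_insert hi, add_comm, add_comm (r i)]
    have hind : iIndepFun (fun j (q : Fin n → ℕ) => q j)
        (Measure.pi fun j => poissonMeasure (r j)) :=
      iIndepFun_pi (X := fun _ => id) fun _ => aemeasurable_id
    refine IndepFun.hasLaw_add_poissonMeasure
      (hind.indepFun_finsetSum_of_notMem (fun j => measurable_pi_apply j) hi) ih ?_
    exact ⟨.of_discrete, (measurePreserving_eval (fun j => poissonMeasure (r j)) i).map_eq⟩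

/-- The numerator `q i` acts as a density; size-biasing trades it for the factor `r i` and turns the
denominator into one plus a Poisson variable. -/
lemma integral_normalizeWeights_pi_poissonMeasure (r : Fin n → ℝ≥0) (i : Fin n)
    (hr : 0 < r i) :
    ∫ q, normalizeWeights q i ∂(Measure.pi fun j => poissonMeasure (r j)) =
      r i * ((1 - Real.exp (-∑ j, (r j : ℝ))) / ∑ j, (r j : ℝ)) := by
  have hpos : 0 < ∑ j, r j := hr.trans_le (Finset.single_le_sum (fun _ _ => zero_le) (Finset.mem_univ i))
  have h1 := integral_withDensity_eq_integral_smul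
    (μ := Measure.pi fun j => poissonMeasure (r j)) (f := fun q : Fin n → ℕ => (q i : ℝ≥0))
    .of_discrete (fun q => 1 / ∑ j, (q j : ℝ))
  have h2 := integral_one_div_one_add_poissonMeasure hpos
  rw [← (hasLaw_sum_pi_poissonMeasure r Finset.univ).integral_comp .of_discrete] at h2
  push_cast at h2
  rw [← h2]
  calc _ = _ := by
        refine Eq.trans ?_ h1.symm
        simp [normalizeWeights, NNReal.smul_def, div_eq_mul_inv]
    _ = _ := by
        rw [withDensity_pi_poissonMeasure, integral_smul_measure,
          integral_map .of_discrete .of_discrete]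
        simp [Finset.sum_add_distrib, Pi.single_apply, add_comm]

/-! ### The integer hull of a class-1 instance. -/

lemma IsClass.half_lt {a : Fin n → ℝ} (ha : IsClass 1 a) (i : Fin n) : 1 / 2 < a i := by
  have := (ha i).1
  norm_num at this ⊢
  exact this

lemma IsClass.le_one {a : Fin n → ℝ} (ha : IsClass 1 a) (i : Fin n) : a i ≤ 1 := by
  simpa using (ha i).2

lemma convex_setOf_nonneg_sum_le_one :
    Convex ℝ {y : Fin n → ℝ | (∀ i, 0 ≤ y i) ∧ ∑ i, y i ≤ 1} := by
  rintro y ⟨hy, hy'⟩ z ⟨hz, hz'⟩ u v hu hv huv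
  refine ⟨fun i => add_nonneg (mul_nonneg hu (hy i)) (mul_nonneg hv (hz i)), ?_⟩
  simp only [Pi.add_apply, Pi.smul_apply, smul_eq_mul, Finset.sum_add_distrib, ← Finset.mul_sum]
  nlinarith

/-- At most one item of a class-`1` instance fits into the knapsack. -/
lemma IsClass.intPolytope_eq {a : Fin n → ℝ} (ha : IsClass 1 a) :
    intPolytope a = {y | (∀ i, 0 ≤ y i) ∧ ∑ i, y i ≤ 1} := by
  have ha0 : ∀ i, 0 < a i := fun i => lt_trans (by norm_num) (ha.half_lt i)
  apply Set.Subset.antisymm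
  · refine convexHull_min ?_ convex_setOf_nonneg_sum_le_one
    rintro z ⟨⟨hz, hz'⟩, hz01⟩
    refine ⟨fun i => (hz i).1, ?_⟩
    by_cases h : ∃ i, z i = 1
    · obtain ⟨i, hi⟩ := h
      rw [Finset.sum_eq_single i, hi]
      · intro j _ hj
        by_contra hj0
        have hj1 := (hz01 j).resolve_left hj0
        have h2 : a i * z i + a j * z j ≤ ∑ k, a k * z k := by
          rw [← Finset.sum_pair hj.symm (f := fun k => a k * z k)]
          exact Finset.sum_le_sum_of_subset_of_nonneg (Finset.subset_univ _)
            fun k _ _ => mul_nonneg (ha0 k).le (hz k).1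
        rw [hi, hj1] at h2
        linarith [ha.half_lt i, ha.half_lt j]
      · simp
    · push Not at h
      rw [Finset.sum_eq_zero fun i _ => (hz01 i).resolve_right (h i)]
      exact zero_le_one
  · rintro y ⟨hy, hy'⟩
    have h0 : (0 : Fin n → ℝ) ∈ intPolytope a :=
      subset_convexHull _ _ ⟨⟨by simp, by simp⟩, by simp⟩
    have h1 : ∀ i, Pi.single i (1 : ℝ) ∈ intPolytope a := fun i => by
      refine subset_convexHull _ _ ⟨⟨fun j => ?_, ?_⟩, fun j => ?_⟩
      · rcases eq_or_ne j i with rfl | hj <;> simp [*]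
      · simpa [Pi.single_apply] using ha.le_one i
      · rcases eq_or_ne j i with rfl | hj <;> simp [*]
    -- The index `none` puts the leftover mass `1 - ∑ i, y i` on the origin.
    have h := Convex.sum_mem (convex_convexHull ℝ {z | z ∈ fracPolytope a ∧ ∀ i, z i = 0 ∨ z i = 1})
      (t := Finset.univ) (w := fun o : Option (Fin n) => o.elim (1 - ∑ i, y i) y)
      (z := fun o => o.elim 0 fun i => Pi.single i 1)
      (by rintro (_ | i) _ <;> simp [*]) (by simp [Fintype.sum_option])
      (by rintro (_ | i) _; exacts [h0, h1 i])
    have e : ∑ o : Option (Fin n), (o.elim (1 - ∑ i, y i) y : ℝ) •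
        (o.elim 0 fun i => Pi.single i 1 : Fin n → ℝ) = y := by
      ext j
      simp [Fintype.sum_option, Pi.single_apply]
    rwa [e] at h

/-! ### Feasibility and monotonicity of the Poisson scheme. -/

lemma normalizeWeights_nonneg (q : Fin n → ℕ) (i : Fin n) : 0 ≤ normalizeWeights q i :=
  div_nonneg (Nat.cast_nonneg _) (Finset.sum_nonneg fun _ _ => Nat.cast_nonneg _)

lemma sum_normalizeWeights_le_one (q : Fin n → ℕ) : ∑ i, normalizeWeights q i ≤ 1 := by
  simp only [normalizeWeights, ← Finset.sum_div]
  exact div_self_le_one _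

lemma norm_normalizeWeights_le_one (q : Fin n → ℕ) (i : Fin n) : ‖normalizeWeights q i‖ ≤ 1 := by
  rw [Real.norm_of_nonneg (normalizeWeights_nonneg q i)]
  exact (Finset.single_le_sum (fun j _ => normalizeWeights_nonneg q j) (Finset.mem_univ i)).trans
    (sum_normalizeWeights_le_one q)

lemma integrable_normalizeWeights (μ : Measure (Fin n → ℕ)) [IsFiniteMeasure μ] (i : Fin n) :
    Integrable (fun q => normalizeWeights q i) μ :=
  .of_bound .of_discrete 1 (.of_forall fun q => norm_normalizeWeights_le_one q i)

/-- The law of the weights before normalization. -/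
noncomputable def weightVectorLaw (x : Fin n → ℝ) (R : Finset (Fin n)) : Measure (Fin n → ℕ) :=
  Measure.pi fun i => if i ∈ R then weightLaw (x i) else Measure.dirac 0

lemma isProbabilityMeasure_ite_weightLaw {x : Fin n → ℝ} (hx : ∀ i, 0 ≤ x i)
    (R : Finset (Fin n)) (i : Fin n) :
    IsProbabilityMeasure (if i ∈ R then weightLaw (x i) else Measure.dirac 0) := by
  have := isProbabilityMeasure_weightLaw (hx i)
  split_ifs <;> infer_instance

lemma isProbabilityMeasure_weightVectorLaw {x : Fin n → ℝ} (hx : ∀ i, 0 ≤ x i)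
    (R : Finset (Fin n)) : IsProbabilityMeasure (weightVectorLaw x R) := by
  have := isProbabilityMeasure_ite_weightLaw hx R
  unfold weightVectorLaw
  infer_instance

lemma integral_poissonScheme (x : Fin n → ℝ) (R : Finset (Fin n)) (i : Fin n) :
    ∫ y, y i ∂(poissonScheme n x R) = ∫ q, normalizeWeights q i ∂(weightVectorLaw x R) :=
  integral_map .of_discrete (measurable_pi_apply i).aestronglyMeasurable

lemma ae_weightVectorLaw_eq_zero {x : Fin n → ℝ} (hx : ∀ i, 0 ≤ x i) (R : Finset (Fin n)) :
    ∀ᵐ q ∂(weightVectorLaw x R), ∀ i, i ∉ R → q i = 0 := by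
  have := isProbabilityMeasure_ite_weightLaw hx R
  rw [ae_all_iff]
  intro i
  by_cases hi : i ∈ R
  · simp [hi]
  have h : ∀ᵐ k ∂(if i ∈ R then weightLaw (x i) else Measure.dirac 0), k = 0 := by
    simp [hi, ae_dirac_eq]
  filter_upwards [Measure.tendsto_eval_ae_ae.eventually h] with q hq _ using hq

lemma isCRS_poissonScheme {a : Fin n → ℝ} (ha : IsClass 1 a) : IsCRS a (poissonScheme n) := by
  intro x hx R _
  have hx0 : ∀ i, 0 ≤ x i := fun i => (hx.1 i).1
  have := isProbabilityMeasure_weightVectorLaw hx0 R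
  refine ⟨Measure.isProbabilityMeasure_map (μ := weightVectorLaw x R) .of_discrete, ?_⟩
  have hmem : ∀ᵐ q ∂(weightVectorLaw x R), normalizeWeights q ∈
      {y : Fin n → ℝ | ((∀ i, 0 ≤ y i) ∧ ∑ i, y i ≤ 1) ∧ ∀ i, y i ≠ 0 → i ∈ R} := by
    filter_upwards [ae_weightVectorLaw_eq_zero hx0 R] with q hq
    refine ⟨⟨normalizeWeights_nonneg q, sum_normalizeWeights_le_one q⟩, fun i hi => ?_⟩
    by_contra h
    simp [normalizeWeights, hq i h] at hi
  rw [ha.intPolytope_eq]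
  refine (ae_map_iff .of_discrete ?_).2 hmem
  measurability

/-- Restricting the weights for `B` to a subset `A` yields the weights for `A`. -/
lemma map_weightVectorLaw {x : Fin n → ℝ} (hx : ∀ i, 0 ≤ x i) {A B : Finset (Fin n)}
    (hAB : A ⊆ B) :
    (weightVectorLaw x B).map (fun q i => if i ∈ A then q i else 0) = weightVectorLaw x A := by
  have := isProbabilityMeasure_ite_weightLaw hx B
  have hm : ∀ i, IsProbabilityMeasure ((if i ∈ B then weightLaw (x i) else Measure.dirac 0).map
      fun k : ℕ => if i ∈ A then k else 0) := fun i => Measure.isProbabilityMeasure_map .of_discrete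
  rw [weightVectorLaw, Measure.pi_map_pi (f := fun i (k : ℕ) => if i ∈ A then k else 0)
    fun i => .of_discrete, weightVectorLaw]
  congr with i : 1
  by_cases hi : i ∈ A
  · simp [hi, hAB hi]
  · simp [hi]

lemma normalizeWeights_le_restrict (q : Fin n → ℕ) {A : Finset (Fin n)} {i : Fin n} (hi : i ∈ A) :
    normalizeWeights q i ≤ normalizeWeights (fun j => if j ∈ A then q j else 0) i := by
  simp only [normalizeWeights, hi, if_true]
  -- Positivity of `q i` keeps the smaller denominator nonzero, which excludes the convention `q / 0
  -- = 0`.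
  rcases Nat.eq_zero_or_pos (q i) with h | h
  · simp [h]
  refine div_le_div_of_nonneg_left (Nat.cast_nonneg _) ?_ (Finset.sum_le_sum fun j _ => ?_)
  · have : (0 : ℝ) < ((if i ∈ A then q i else 0 : ℕ) : ℝ) := by simpa [hi] using h
    exact this.trans_le (Finset.single_le_sum (f := fun j => ((if j ∈ A then q j else 0 : ℕ) : ℝ))
      (fun _ _ => Nat.cast_nonneg _) (Finset.mem_univ i))
  · split_ifs <;> simp

lemma isMonotone_poissonScheme (a : Fin n → ℝ) : IsMonotone a (poissonScheme n) := by
  intro x hx A B hAB _ i hi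
  have hx0 : ∀ i, 0 ≤ x i := fun i => (hx.1 i).1
  have := isProbabilityMeasure_weightVectorLaw hx0 B
  rw [integral_poissonScheme, integral_poissonScheme, ← map_weightVectorLaw hx0 hAB,
    integral_map .of_discrete .of_discrete]
  refine integral_mono (integrable_normalizeWeights _ i)
    (.of_bound .of_discrete 1 (.of_forall fun q => norm_normalizeWeights_le_one _ i))
    fun q => normalizeWeights_le_restrict q hi

/-! ### Balancedness. -/

lemma inclusionProb_nonneg {x : Fin n → ℝ} (hx : ∀ i, 0 ≤ x i ∧ x i ≤ 1) (R : Finset (Fin n)) :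
    0 ≤ inclusionProb x R :=
  mul_nonneg (Finset.prod_nonneg fun i _ => (hx i).1)
    (Finset.prod_nonneg fun i _ => sub_nonneg.2 (hx i).2)

/-- Each Poisson factor splits into an "included" and an "excluded" part; expanding the product of
these sums yields one term per set `R`. -/
lemma sum_inclusionProb_smul_weightVectorLaw {x : Fin n → ℝ} (hx : ∀ i, 0 ≤ x i ∧ x i ≤ 1) :
    ∑ R : Finset (Fin n), ENNReal.ofReal (inclusionProb x R) • weightVectorLaw x R =
      Measure.pi fun i => poissonMeasure (x i).toNNReal := by
  refine Measure.ext_of_singleton fun q => ?_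
  rw [Measure.pi_singleton, Measure.finsetSum_apply]
  simp only [← ofReal_smul_weightLaw_add (hx _).1 (hx _).2, Measure.add_apply, Measure.smul_apply,
    smul_eq_mul, Fintype.prod_add]
  refine Finset.sum_congr rfl fun R _ => ?_
  have := isProbabilityMeasure_ite_weightLaw (fun i => (hx i).1) R
  rw [weightVectorLaw, Measure.pi_singleton, inclusionProb,
    ENNReal.ofReal_mul (Finset.prod_nonneg fun i _ => (hx i).1),
    ENNReal.ofReal_prod_of_nonneg fun i _ => (hx i).1,
    ENNReal.ofReal_prod_of_nonneg fun i _ => sub_nonneg.2 (hx i).2,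
    ← Finset.prod_mul_prod_compl R, Finset.prod_mul_distrib, Finset.prod_mul_distrib]
  have h1 : ∏ i ∈ R, (if i ∈ R then weightLaw (x i) else Measure.dirac 0) {q i} =
      ∏ i ∈ R, weightLaw (x i) {q i} :=
    Finset.prod_congr rfl fun i hi => by rw [if_pos hi]
  have h2 : ∏ i ∈ Rᶜ, (if i ∈ R then weightLaw (x i) else Measure.dirac 0) {q i} =
      ∏ i ∈ Rᶜ, (Measure.dirac 0 : Measure ℕ) {q i} :=
    Finset.prod_congr rfl fun i hi => by rw [if_neg (Finset.mem_compl.1 hi)]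
  rw [h1, h2]
  ring

lemma sum_inclusionProb_mul_integral_poissonScheme {x : Fin n → ℝ}
    (hx : ∀ i, 0 ≤ x i ∧ x i ≤ 1) (i : Fin n) :
    ∑ R : Finset (Fin n), inclusionProb x R * ∫ y, y i ∂(poissonScheme n x R) =
      ∫ q, normalizeWeights q i ∂(Measure.pi fun j => poissonMeasure (x j).toNNReal) := by
  rw [← sum_inclusionProb_smul_weightVectorLaw hx, integral_finsetSum_measure]
  · refine Finset.sum_congr rfl fun R _ => ?_
    rw [integral_smul_measure, integral_poissonScheme,
      ENNReal.toReal_ofReal (inclusionProb_nonneg hx R), smul_eq_mul]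
  · intro R _
    have := isProbabilityMeasure_weightVectorLaw (fun i => (hx i).1) R
    exact (integrable_normalizeWeights _ i).smul_measure ENNReal.ofReal_ne_top

lemma IsClass.sum_le_two {a x : Fin n → ℝ} (ha : IsClass 1 a) (hx : x ∈ fracPolytope a) :
    ∑ i, x i ≤ 2 := by
  have : ∑ i, 1 / 2 * x i ≤ ∑ i, a i * x i :=
    Finset.sum_le_sum fun i _ => mul_le_mul_of_nonneg_right (ha.half_lt i).le (hx.1 i).1
  rw [← Finset.mul_sum] at this
  linarith [hx.2]

lemma isBalanced_poissonScheme {a : Fin n → ℝ} (ha : IsClass 1 a) :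
    IsBalanced ((1 - Real.exp (-2)) / 2) a (poissonScheme n) := by
  intro x hx i hi
  have hi0 : 0 < x i := lt_of_le_of_ne (hx.1 i).1 hi.symm
  have hs : 0 < ∑ j, x j :=
    hi0.trans_le (Finset.single_le_sum (fun j _ => (hx.1 j).1) (Finset.mem_univ i))
  rw [sum_inclusionProb_mul_integral_poissonScheme hx.1,
    integral_normalizeWeights_pi_poissonMeasure _ i (Real.toNNReal_pos.2 hi0)]
  simp only [Real.coe_toNNReal _ (hx.1 _).1]
  rw [mul_comm]
  exact mul_le_mul_of_nonneg_left (one_sub_exp_neg_div_antitone hs (ha.sum_le_two hx)) hi0.le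

/-! ### Optimality. -/

lemma sum_inclusionProb (x : Fin n → ℝ) : ∑ R : Finset (Fin n), inclusionProb x R = 1 := by
  simp only [inclusionProb, ← Fintype.prod_add, add_sub_cancel, Finset.prod_const_one]

/-- No scheme selects more than one item in total, and none if no item is available. -/
lemma IsBalanced.mul_sum_le {a : Fin n → ℝ} (ha : IsClass 1 a) {π : Scheme n} {c : ℝ}
    (hπ : IsCRS a π) (hc : IsBalanced c a π) {x : Fin n → ℝ} (hx : x ∈ fracPolytope a)
    (hx0 : ∀ i, x i ≠ 0) : c * ∑ i, x i ≤ 1 - ∏ i, (1 - x i) := by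
  have hbound : ∀ R : Finset (Fin n),
      ∑ i, ∫ y, y i ∂(π x R) ≤ if R = ∅ then 0 else 1 := by
    intro R
    obtain ⟨hprob, hae⟩ := hπ x hx R fun i _ => hx0 i
    rw [ha.intPolytope_eq] at hae
    have hint : ∀ i ∈ Finset.univ, Integrable (fun y : Fin n → ℝ => y i) (π x R) := fun i _ => by
      refine .of_bound (measurable_pi_apply i).aestronglyMeasurable 1 ?_
      filter_upwards [hae] with y hy
      rw [Real.norm_of_nonneg (hy.1.1 i)]
      exact (Finset.single_le_sum (fun j _ => hy.1.1 j) (Finset.mem_univ i)).trans hy.1.2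
    rw [← integral_finsetSum _ hint]
    calc ∫ y, ∑ i, y i ∂(π x R) ≤ ∫ _, (if R = ∅ then 0 else 1 : ℝ) ∂(π x R) := by
          refine integral_mono_ae (integrable_finsetSum _ hint) (integrable_const _) ?_
          filter_upwards [hae] with y hy
          split_ifs with hR
          · subst hR
            refine (Finset.sum_eq_zero fun i _ => ?_).le
            by_contra h
            simpa using hy.2 i h
          · exact hy.1.2
      _ = _ := by simp
  calc c * ∑ i, x i = ∑ i, c * x i := Finset.mul_sum _ _ _
    _ ≤ ∑ i, ∑ R : Finset (Fin n), inclusionProb x R * ∫ y, y i ∂(π x R) :=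
        Finset.sum_le_sum fun i _ => hc x hx i (hx0 i)
    _ = ∑ R : Finset (Fin n), inclusionProb x R * ∑ i, ∫ y, y i ∂(π x R) := by
        rw [Finset.sum_comm]; simp only [Finset.mul_sum]
    _ ≤ ∑ R : Finset (Fin n), inclusionProb x R * (if R = ∅ then 0 else 1) :=
        Finset.sum_le_sum fun R _ => mul_le_mul_of_nonneg_left (hbound R) (inclusionProb_nonneg hx.1 R)
    _ = ∑ R : Finset (Fin n), (inclusionProb x R - if R = ∅ then inclusionProb x R else 0) :=
        Finset.sum_congr rfl fun R _ => by split_ifs <;> ring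
    _ = 1 - ∏ i, (1 - x i) := by
        rw [Finset.sum_sub_distrib, sum_inclusionProb]
        simp [inclusionProb]

/-- The identical items of size slightly above `1 / 2` bound the balancedness of all schemes. -/
lemma le_of_forall_exists_isBalanced {c : ℝ}
    (h : ∀ (n : ℕ) (a : Fin n → ℝ), IsClass 1 a → ∃ π : Scheme n, IsCRS a π ∧ IsBalanced c a π) :
    c ≤ (1 - Real.exp (-2)) / 2 := by
  have key : ∀ n : ℕ, 0 < n →
      c * (2 * (n / (n + 1 : ℝ))) ≤ 1 - (1 + -2 / ((n + 1 : ℕ) : ℝ)) ^ (n + 1) := by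
    intro n hn
    have hn1 : (1 : ℝ) ≤ n := by exact_mod_cast hn
    -- With this size, `x i = 2 / (n + 1)` fills the capacity exactly.
    have ha : IsClass 1 fun _ : Fin n => (n + 1 : ℝ) / (2 * n) := by
      intro i
      constructor
      · rw [div_lt_div_iff₀ (by norm_num) (by positivity)]; push_cast; linarith
      · rw [div_le_div_iff₀ (by positivity) (by norm_num)]; push_cast; linarith
    have hle : 2 / (n + 1 : ℝ) ≤ 1 := by rw [div_le_one (by positivity)]; linarith
    have hx : (fun _ => 2 / (n + 1 : ℝ)) ∈ fracPolytope fun _ : Fin n => (n + 1 : ℝ) / (2 * n) := by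
      refine ⟨fun i => ⟨by positivity, hle⟩, le_of_eq ?_⟩
      rw [Finset.sum_const, Finset.card_univ, Fintype.card_fin, nsmul_eq_mul]
      field_simp
    obtain ⟨π, hπ, hb⟩ := h n _ ha
    have hmain := hb.mul_sum_le ha hπ hx fun _ => by positivity
    simp only [Finset.sum_const, Finset.prod_const, Finset.card_univ, Fintype.card_fin,
      nsmul_eq_mul] at hmain
    -- The base lies in `[0, 1]`, so an extra factor only weakens the bound; it produces the form
    -- `(1 - 2/m)^m` with limit `e^{-2}`.
    have hpow : (1 + -2 / ((n + 1 : ℕ) : ℝ)) ^ (n + 1) ≤ (1 - 2 / (n + 1 : ℝ)) ^ n := by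
      rw [Nat.cast_add_one, neg_div, ← sub_eq_add_neg]
      exact pow_le_pow_of_le_one (by linarith) (by linarith [show 0 ≤ 2 / (n + 1 : ℝ) by positivity])
        n.le_succ
    calc c * (2 * (n / (n + 1 : ℝ))) = c * (n * (2 / (n + 1 : ℝ))) := by ring
      _ ≤ _ := by linarith
  have hl : Filter.Tendsto (fun n : ℕ => c * (2 * (n / (n + 1 : ℝ)))) Filter.atTop
      (nhds (c * (2 * 1))) :=
    (tendsto_natCast_div_add_atTop (1 : ℝ)).const_mul 2 |>.const_mul c
  have hr : Filter.Tendsto (fun n : ℕ => 1 - (1 + -2 / ((n + 1 : ℕ) : ℝ)) ^ (n + 1)) Filter.atTop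
      (nhds (1 - Real.exp (-2))) :=
    ((Real.tendsto_one_add_div_pow_exp (-2)).comp (Filter.tendsto_add_atTop_nat 1)).const_sub 1
  have := le_of_tendsto_of_tendsto hl hr
    (Filter.eventually_atTop.2 ⟨1, fun n hn => key n hn⟩)
  linarith

end Knapsack

theorem mainTheorem2 :
    -- the Poisson-weighted scheme is a monotone, balanced scheme for class-1 instances
    (∀ (n : ℕ) (a : Fin n → ℝ), Knapsack.IsClass 1 a →
      Knapsack.IsCRS a (Knapsack.poissonScheme n) ∧
      Knapsack.IsMonotone a (Knapsack.poissonScheme n) ∧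
      Knapsack.IsBalanced ((1 - Real.exp (-2)) / 2) a (Knapsack.poissonScheme n)) ∧
    -- the constant is the expectation of 1 / (1 + Pois(2))
    (∫ k : ℕ, 1 / (1 + (k : ℝ)) ∂(poissonMeasure 2)) = (1 - Real.exp (-2)) / 2 ∧
    -- no larger balancedness is possible for all class-1 instances, even without monotonicity
    (∀ c : ℝ,
      (∀ (n : ℕ) (a : Fin n → ℝ), Knapsack.IsClass 1 a →
        ∃ π : Knapsack.Scheme n, Knapsack.IsCRS a π ∧ Knapsack.IsBalanced c a π) →
      c ≤ (1 - Real.exp (-2)) / 2) := by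
  refine ⟨fun n a ha => ⟨Knapsack.isCRS_poissonScheme ha, Knapsack.isMonotone_poissonScheme a,
    Knapsack.isBalanced_poissonScheme ha⟩, ?_, fun c h => Knapsack.le_of_forall_exists_isBalanced h⟩
  simpa using Knapsack.integral_one_div_one_add_poissonMeasure (r := 2) (by norm_num)
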